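/- Let $d\ge 1$. A Borel measure on $\mathbb{R}^d$ is called isotropic unimodal if on $\mathbb{R}^d\setminus\{0\}$ it is absolutely continuous with a finite radial nonincreasing density (an atom at $0$ is allowed). Let $X=(X_t)_{t\ge 0}$ be a pure-jump isotropic unimodal Lévy process in $\mathbb{R}^d$ with nonzero Lévy measure $\nu$; that is, the law of each $X_t$ is isotropic unimodal, with density $p_t(x)$ on $\mathbb{R}^d\setminus\{0\}$ and $p_t(0):=\lim_{x\to 0}p_t(x)\in[0,\infty]$, and $$\mathbb{E}e^{i\langle \xi,X_t\rangle}=e^{-t\psi(\xi)},\qquad \psi(\xi)=\int_{\mathbb{R}^d}(1-\cos\langle\xi,x\rangle)\,\nu(dx).$$ The exponent $\psi$ is radial, and we write $\psi(u)=\psi(\xi)$ for $u=|\xi|$. Put $\psi^*(u)=\sup_{0\le s\le u}\psi(s)$ for $u\ge 0$, and $\psi^-(v)=\inf\{s\ge 0:\psi^*(s)\ge v\}$ for $v\ge 0$, where $\inf\emptyset=\infty$. For $\theta\ge 0$, $\underline\alpha,\overline\alpha\in(0,2)$, $\underline c\in(0,1]$, $\overline C\in[1,\infty)$, write $\psi\in\mathrm{WLSC}(\underline\alpha,\theta,\underline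 c)$ if $\psi(\lambda\eta)\ge\underline c\,\lambda^{\underline\alpha}\psi(\eta)$ for all $\lambda\ge1$, $\eta>\theta$, and $\psi\in\mathrm{WUSC}(\overline\alpha,\theta,\overline C)$ if $\psi(\lambda\eta)\le\overline C\,\lambda^{\overline\alpha}\psi(\eta)$ for all $\lambda\ge1$, $\eta>\theta$. (i) If $\psi\in\mathrm{WLSC}(\underline\alpha,\theta,\underline c)$, then there is a constant $C^*=C^*(d,\underline\alpha,\underline c)\in(0,\infty)$ such that $$p_t(x)\le C^*\min\left\{[\psi^-(1/t)]^d,\ \frac{t\psi^*(1/|x|)}{|x|^d}\right\}\qquad\text{if } t>0,\ t\psi^*(\theta)<1/\pi^2,\ x\in\mathbb{R}^d.$$ (ii) If $\psi\in\mathrm{WLSC}(\underline\alpha,\theta,\underline c)\cap\mathrm{WUSC}(\overline\alpha,\theta,\overline C)$, then there are constants $c^*=c^*(d,\underline\alpha,\underline c,\overline\alpha,\overline C)>0$ and $r_0=r_0(d,\underline\alpha,\underline c,\overline\alpha,\overline C)>0$ such that $$p_t(x)\ge c^*\min\left\{[\psi^-(1/t)]^d,\ \frac{t\psi^*(1/|x|)}{|x|^d}\right\}\qquad\text{if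 } t>0,\ t\psi^*(\theta/r_0)<1,\ |x|<r_0/\theta,$$ where $r_0/\theta=\infty$ if $\theta=0$. For $x=0$ the second term of the minima is ignored, i.e. the minimum is understood as $[\psi^-(1/t)]^d$. -/

import Mathlib

open MeasureTheory ProbabilityTheory Filter Topology
open scoped NNReal ENNReal

noncomputable section

namespace UnimodalLevy

/-- Euclidean space `ℝ^d`. -/
abbrev E (d : ℕ) : Type := EuclideanSpace ℝ (Fin d)

/-- `X` is a Lévy process in `ℝ^d` on the probability space `(Ω, P)`: it starts at `0`, has
independent and stationary increments, and its paths are almost surely right-continuous with left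
limits. -/
structure IsLevyProcess {d : ℕ} {Ω : Type*} [MeasurableSpace Ω] (P : Measure Ω)
    (X : ℝ≥0 → Ω → E d) : Prop where
  measurable : ∀ t, Measurable (X t)
  start_zero : ∀ᵐ ω ∂P, X 0 ω = 0
  indep_increments : HasIndepIncrements X P
  stationary_increments : ∀ s t, P.map (fun ω => X (s + t) ω - X s ω) = P.map (X t)
  cadlag : ∀ᵐ ω ∂P, ∀ t : ℝ≥0,
    ContinuousWithinAt (fun s => X s ω) (Set.Ici t) t ∧
      ∃ l : E d, Tendsto (fun s => X s ω) (𝓝[<] t) (𝓝 l)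

/-- A Lévy measure on `ℝ^d`: it is concentrated on `ℝ^d ∖ {0}` and integrates `|x|² ∧ 1`. -/
structure IsLevyMeasure {d : ℕ} (ν : Measure (E d)) : Prop where
  zero_singleton : ν {0} = 0
  lintegral_lt_top : ∫⁻ x, ENNReal.ofReal (min (‖x‖ ^ 2) 1) ∂ν < ∞

/-- `f` is a finite radial nonincreasing density of the measure `m` on `ℝ^d ∖ {0}` with respect to
the Lebesgue measure. The value `f 0`, on which the density property does not depend, is
normalized to be the limit of `f x` as `x → 0`, that is, the supremum of `f` off the origin
(it may be infinite). -/
structure IsUnimodalDensity {d : ℕ} (m : Measure (E d)) (f : E d → ℝ≥0∞) : Prop where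
  lt_top : ∀ x, x ≠ 0 → f x < ∞
  radial_antitone : ∀ x y, x ≠ 0 → y ≠ 0 → ‖x‖ ≤ ‖y‖ → f y ≤ f x
  density : m.restrict {0}ᶜ = (volume.restrict {0}ᶜ).withDensity f
  value_zero : f 0 = ⨆ (x : E d) (_ : x ≠ 0), f x

/-- Isotropic unimodal measures on `ℝ^d` (an atom at the origin is allowed). -/
def IsUnimodal {d : ℕ} (m : Measure (E d)) : Prop := ∃ f, IsUnimodalDensity m f

/-- The Lévy–Khintchine exponent `ψ(ξ) = ∫ (1 - cos ⟨ξ, x⟩) ν(dx)` of the Lévy measure `ν`. -/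
def levyExponent {d : ℕ} (ν : Measure (E d)) (ξ : E d) : ℝ :=
  ∫ x, (1 - Real.cos (inner ℝ ξ x)) ∂ν

/-- The exponent as a function of `u = |ξ|`, namely its value at `ξ = u e₁`. (For an isotropic
process the exponent is a radial function, so the direction does not matter.) -/
def radialExponent {d : ℕ} [NeZero d] (ν : Measure (E d)) (u : ℝ) : ℝ :=
  levyExponent ν (EuclideanSpace.single (0 : Fin d) u)

/-- `X` is a pure-jump isotropic unimodal Lévy process in `ℝ^d` with nonzero Lévy measure `ν`:
all its one-dimensional distributions are isotropic unimodal, and the Lévy–Khintchine formula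
`𝔼 exp(i⟨ξ, X_t⟩) = exp(-t ψ(ξ))` holds with the exponent `ψ` of `ν`. -/
structure IsPureJumpUnimodalLevyProcess {d : ℕ} {Ω : Type*} [MeasurableSpace Ω] (P : Measure Ω)
    (X : ℝ≥0 → Ω → E d) (ν : Measure (E d)) : Prop extends IsLevyProcess P X where
  unimodal : ∀ t, IsUnimodal (P.map (X t))
  levyMeasure : IsLevyMeasure ν
  levyMeasure_ne_zero : ν ≠ 0
  charFun_eq : ∀ (t : ℝ≥0) (ξ : E d),
    charFun (P.map (X t)) ξ = Complex.exp (-((t : ℝ) * levyExponent ν ξ : ℝ))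

/-- `p t x` is the transition density `p_t(x)` of `X`, for `t > 0`. -/
def IsTransitionDensity {d : ℕ} {Ω : Type*} [MeasurableSpace Ω] (P : Measure Ω)
    (X : ℝ≥0 → Ω → E d) (p : ℝ≥0 → E d → ℝ≥0∞) : Prop :=
  ∀ t, 0 < t → IsUnimodalDensity (P.map (X t)) (p t)

/-- The nondecreasing majorant `φ*(u) = sup_{0 ≤ s ≤ u} φ(s)`. -/
def maximalFunction (φ : ℝ → ℝ) (u : ℝ) : ℝ := sSup (φ '' Set.Icc 0 u)

/-- The generalized inverse `φ⁻(v) = inf {s ≥ 0 : φ(s) ≥ v}`, with `inf ∅ = ∞`. -/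
def genInverse (φ : ℝ → ℝ) (v : ℝ) : ℝ≥0∞ := ⨅ (s : ℝ≥0) (_ : v ≤ φ s), (s : ℝ≥0∞)

/-- `ψ* = sup_{0 ≤ s ≤ u} ψ(s)`. -/
def psiStar {d : ℕ} [NeZero d] (ν : Measure (E d)) : ℝ → ℝ := maximalFunction (radialExponent ν)

/-- `ψ⁻ = (ψ*)⁻`. -/
def psiInv {d : ℕ} [NeZero d] (ν : Measure (E d)) : ℝ → ℝ≥0∞ := genInverse (psiStar ν)

/-- Weak lower scaling: `φ(lθ') ≥ c l^α φ(θ')` for `l ≥ 1`, `θ' > θ`. -/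
def WLSC (φ : ℝ → ℝ) (α θ c : ℝ) : Prop :=
  ∀ l η : ℝ, 1 ≤ l → θ < η → c * l ^ α * φ η ≤ φ (l * η)

/-- Weak upper scaling: `φ(lθ') ≤ C l^α φ(θ')` for `l ≥ 1`, `θ' > θ`. -/
def WUSC (φ : ℝ → ℝ) (α θ C : ℝ) : Prop :=
  ∀ l η : ℝ, 1 ≤ l → θ < η → φ (l * η) ≤ C * l ^ α * φ η

open Classical in
/-- `min {[ψ⁻(1/t)]^d, t ψ*(1/|x|) / |x|^d}`, where for `x = 0` the second term is ignored. -/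
def commonBound {d : ℕ} [NeZero d] (ν : Measure (E d)) (t : ℝ) (x : E d) : ℝ≥0∞ :=
  if x = 0 then psiInv ν (1 / t) ^ d
  else min (psiInv ν (1 / t) ^ d) (ENNReal.ofReal (t * psiStar ν (1 / ‖x‖) / ‖x‖ ^ d))

end UnimodalLevy

end

open UnimodalLevy

/-! Let u = ψ⁻(1/t). Lower scaling forces ψ to be unbounded, so u is finite and tψ(u) = tψ*(u) = 1.
The smallness condition on t places u beyond the threshold where scaling starts. A radially
nonincreasing density is comparable to averages: f(x) is at most the mass of an annulus inside {‖y‖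
≤ ‖x‖} divided by its volume, and at least the same quotient for a shell outside ‖x‖. Both bounds
thus reduce to estimates of masses through ψ.

Upper bound. Testing against a Gaussian gives P(‖X_t‖ ≤ r) ≤ e r^d ∫|charFun|, and lower scaling
from u makes this integral O(u^d); this yields the term u^d. For the other term, unimodality gives
P(⟨ξ, X_t⟩ ≥ π) ≤ E(1 - cos⟨ξ, X_t⟩) ≤ tψ(ξ) (`measure_halfspace_le`), hence P(‖X_t‖ ≥ R) ≤ B
tψ(1/R), with B depending only on d.

Lower bound. Let T = tψ*(1/r) ≤ 1. The mean of 1 - cos at a frequency s ≤ 1/r maximizing ψ is at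
least T/2. Upper scaling with exponent below 2 makes the contribution of ‖x‖ < δr at most T/4 for
small δ, so mass at least T/8 lies beyond δr. Lower scaling and the tail bound leave at most T/16
beyond Kr. The shell between carries at least T/16, which bounds the density from below on ‖x‖ ≤ δr
(`exists_density_lower_bound`). Taking r proportional to max(‖x‖, 1/u) gives both terms of the
minimum. -/

namespace UnimodalLevy

/-! ### Unimodal measures: density against mass, the half-space inequality, rotation invariance. -/

section Unimodal

variable {d : ℕ} {m : Measure (E d)} {f : E d → ℝ≥0∞}

namespace IsUnimodalDensity

/-- The normalization at the origin makes a unimodal density antitone in the norm everywhere. -/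
lemma antitone_norm (hf : IsUnimodalDensity m f) {x y : E d} (h : ‖x‖ ≤ ‖y‖) : f y ≤ f x := by
  rcases eq_or_ne y 0 with rfl | hy
  · have : x = 0 := by simpa using h
    rw [this]
  rcases eq_or_ne x 0 with rfl | hx
  · rw [hf.value_zero]
    exact le_iSup₂ (f := fun (x : E d) (_ : x ≠ 0) => f x) y hy
  · exact hf.radial_antitone x y hx hy h

lemma eq_of_norm_eq (hf : IsUnimodalDensity m f) {x y : E d} (h : ‖x‖ = ‖y‖) : f x = f y :=
  le_antisymm (hf.antitone_norm h.ge) (hf.antitone_norm h.le)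

variable [NeZero d]

protected lemma measurable (hf : IsUnimodalDensity m f) : Measurable f := by
  -- The truncation `max s 0` keeps the profile antitone on the negative axis, where the norm would
  -- grow as `s` decreases.
  have hanti : Antitone fun s : ℝ => f (EuclideanSpace.single (0 : Fin d) (max s 0)) := by
    intro s s' h
    apply hf.antitone_norm
    simp only [PiLp.norm_single, Real.norm_eq_abs]
    rw [abs_of_nonneg (le_max_right _ _), abs_of_nonneg (le_max_right _ _)]
    exact max_le_max_right 0 h
  have : f = (fun s : ℝ => f (EuclideanSpace.single (0 : Fin d) (max s 0))) ∘ fun x => ‖x‖ := by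
    funext x
    apply hf.eq_of_norm_eq
    simp
  rw [this]
  exact hanti.measurable.comp measurable_norm

lemma restrict_eq_withDensity (hf : IsUnimodalDensity m f) :
    m.restrict {0}ᶜ = volume.withDensity f := by
  rw [hf.density, Measure.restrict_eq_self_of_ae_mem]
  exact compl_mem_ae_iff.2 (measure_singleton 0)

lemma measure_eq_setLIntegral (hf : IsUnimodalDensity m f) {S : Set (E d)}
    (hS : MeasurableSet S) (h0 : (0 : E d) ∉ S) : m S = ∫⁻ x in S, f x := by
  rw [← withDensity_apply _ hS, ← hf.restrict_eq_withDensity, Measure.restrict_apply hS,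
    Set.inter_eq_left.2]
  exact Set.subset_compl_singleton_iff.2 h0

/-- Equality can fail because of an atom of `m` at the origin. -/
lemma lintegral_mul_le (hf : IsUnimodalDensity m f) {g : E d → ℝ≥0∞} (hg : Measurable g) :
    ∫⁻ x, f x * g x ≤ ∫⁻ x, g x ∂m := by
  calc ∫⁻ x, f x * g x = ∫⁻ x, g x ∂(m.restrict {0}ᶜ) := by
        rw [hf.restrict_eq_withDensity, lintegral_withDensity_eq_lintegral_mul _ hf.measurable hg]
        rfl
    _ ≤ ∫⁻ x, g x ∂m := lintegral_mono' Measure.restrict_le_self le_rfl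

lemma mul_volume_le (hf : IsUnimodalDensity m f) {S : Set (E d)} (hS : MeasurableSet S)
    (h0 : (0 : E d) ∉ S) {x : E d} (hx : ∀ y ∈ S, ‖y‖ ≤ ‖x‖) : f x * volume S ≤ m S := by
  rw [hf.measure_eq_setLIntegral hS h0, ← setLIntegral_const]
  exact setLIntegral_mono' hS fun y hy => hf.antitone_norm (hx y hy)

lemma measure_le_mul_volume (hf : IsUnimodalDensity m f) {S : Set (E d)} (hS : MeasurableSet S)
    (h0 : (0 : E d) ∉ S) {x : E d} (hx : ∀ y ∈ S, ‖x‖ ≤ ‖y‖) : m S ≤ f x * volume S := by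
  rw [hf.measure_eq_setLIntegral hS h0, ← setLIntegral_const]
  exact setLIntegral_mono' hS fun y hy => hf.antitone_norm (hx y hy)

/-- The density at `x` is controlled by the mass of the annulus `‖x‖ / 2 ≤ ‖y‖ ≤ ‖x‖`. -/
lemma le_measure_annulus (hf : IsUnimodalDensity m f) {x : E d} (hx : x ≠ 0) :
    f x * (ENNReal.ofReal ((‖x‖ / 4) ^ d) * volume (Metric.ball (0 : E d) 1)) ≤
      m {y | ‖x‖ / 2 ≤ ‖y‖ ∧ ‖y‖ ≤ ‖x‖} := by
  have hx0 : 0 < ‖x‖ := norm_pos_iff.2 hx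
  have hsub : Metric.ball ((3 / 4 : ℝ) • x) (‖x‖ / 4) ⊆ {y | ‖x‖ / 2 ≤ ‖y‖ ∧ ‖y‖ ≤ ‖x‖} := by
    intro y hy
    rw [mem_ball_iff_norm] at hy
    have h1 : ‖(3 / 4 : ℝ) • x‖ = 3 / 4 * ‖x‖ := by rw [norm_smul]; norm_num
    have h2 := norm_sub_norm_le y ((3 / 4 : ℝ) • x)
    have h3 := norm_sub_norm_le ((3 / 4 : ℝ) • x) y
    rw [norm_sub_rev] at h3
    exact ⟨by linarith, by linarith⟩
  have hvol : volume (Metric.ball ((3 / 4 : ℝ) • x) (‖x‖ / 4)) =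
      ENNReal.ofReal ((‖x‖ / 4) ^ d) * volume (Metric.ball (0 : E d) 1) := by
    rw [Measure.addHaar_ball_of_pos _ _ (by positivity), finrank_euclideanSpace_fin]
  rw [← hvol]
  refine (hf.mul_volume_le measurableSet_ball ?_ fun y hy => (hsub hy).2).trans
    (measure_mono hsub)
  intro h
  have := (hsub h).1
  simp only [norm_zero] at this
  linarith

/-- Tails of a unimodal measure are controlled by its characteristic function at one point. -/
lemma measure_halfspace_le (hf : IsUnimodalDensity m f) {ξ : E d} (hξ : ξ ≠ 0) :
    m {x | Real.pi ≤ inner ℝ ξ x} ≤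
      ∫⁻ x, ENNReal.ofReal (1 - Real.cos (inner ℝ ξ x)) ∂m := by
  set g : E d → ℝ≥0∞ := fun x => ENNReal.ofReal (1 - Real.cos (inner ℝ ξ x)) with hg
  -- A shift by half a period of the cosine: 1 - cos at x and at x - h add up to 2, and on the
  -- half-space the shift does not increase the norm, hence does not decrease f. So 2 m(S) is
  -- bounded by two copies of ∫ f g.
  set h : E d := (Real.pi / ‖ξ‖ ^ 2) • ξ with hh
  set S : Set (E d) := {x | Real.pi ≤ inner ℝ ξ x} with hSdef
  have hξ0 : 0 < ‖ξ‖ := norm_pos_iff.2 hξ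
  have hgm : Measurable g := by fun_prop
  have hS : MeasurableSet S := measurableSet_le measurable_const (by fun_prop)
  have h0 : (0 : E d) ∉ S := by simp [hSdef, Real.pi_pos]
  have hξh : inner ℝ ξ h = Real.pi := by
    rw [hh, inner_smul_right, real_inner_self_eq_norm_sq]
    field_simp
  have hshift : ∀ x, g x + g (x - h) = 2 := by
    intro x
    simp only [hg, inner_sub_right, hξh, Real.cos_sub_pi]
    rw [← ENNReal.ofReal_add (by linarith [Real.cos_le_one (inner ℝ ξ x)])
      (by linarith [Real.neg_one_le_cos (inner ℝ ξ x)])]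
    ring_nf
    simp
  have hnorm : ∀ x ∈ S, ‖x - h‖ ≤ ‖x‖ := by
    intro x hx
    have hhh : ‖h‖ ^ 2 = Real.pi / ‖ξ‖ ^ 2 * Real.pi := by
      rw [← real_inner_self_eq_norm_sq, hh, inner_smul_left, ← hh, hξh]; simp
    have hxh : inner ℝ x h = Real.pi / ‖ξ‖ ^ 2 * inner ℝ ξ x := by
      rw [hh, inner_smul_right, real_inner_comm]
    have hle : Real.pi / ‖ξ‖ ^ 2 * Real.pi ≤ Real.pi / ‖ξ‖ ^ 2 * inner ℝ ξ x :=
      mul_le_mul_of_nonneg_left hx (by positivity)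
    have hpos : 0 ≤ Real.pi / ‖ξ‖ ^ 2 * Real.pi := by positivity
    refine le_of_sq_le_sq ?_ (norm_nonneg _)
    rw [norm_sub_sq_real, hhh, hxh]
    linarith
  have hfm := hf.measurable
  have key : 2 * m S ≤ 2 * ∫⁻ x, g x ∂m := by
    calc 2 * m S = ∫⁻ x in S, f x * (g x + g (x - h)) := by
          simp_rw [hshift]
          rw [lintegral_mul_const _ hfm, hf.measure_eq_setLIntegral hS h0, mul_comm]
      _ ≤ ∫⁻ x in S, (f x * g x + f (x - h) * g (x - h)) := by
          refine setLIntegral_mono' hS fun x hx => ?_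
          rw [mul_add]
          gcongr
          exact hf.antitone_norm (hnorm x hx)
      _ ≤ ∫⁻ x, (f x * g x + f (x - h) * g (x - h)) := setLIntegral_le_lintegral _ _
      _ = (∫⁻ x, f x * g x) + ∫⁻ x, f (x - h) * g (x - h) :=
          lintegral_add_left (hfm.mul hgm) _
      _ = 2 * ∫⁻ x, f x * g x := by
          rw [lintegral_sub_right_eq_self (fun x => f x * g x) h, two_mul]
      _ ≤ 2 * ∫⁻ x, g x ∂m := mul_le_mul_right (hf.lintegral_mul_le hgm) _
  exact (ENNReal.mul_le_mul_iff_right (by simp) (by simp)).1 key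

/-- Off the origin both Lebesgue measure and the density are invariant; a possible atom at 0 is
fixed by the isometry and is split off separately. -/
lemma map_linearIsometryEquiv (hf : IsUnimodalDensity m f) (U : E d ≃ₗᵢ[ℝ] E d) :
    m.map U = m := by
  have hU : Measurable U := U.continuous.measurable
  have off : ∀ S, MeasurableSet S → (0 : E d) ∉ S → m (U ⁻¹' S) = m S := by
    intro S hS h0
    rw [hf.measure_eq_setLIntegral hS h0, hf.measure_eq_setLIntegral (hU hS) (by simpa using h0),
      ← U.measurePreserving.setLIntegral_comp_preimage hS hf.measurable]
    exact lintegral_congr fun x => hf.eq_of_norm_eq (by simp)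
  ext S hS
  rw [Measure.map_apply hU hS, ← measure_inter_add_sdiff S (measurableSet_singleton 0),
    ← measure_inter_add_sdiff (U ⁻¹' S) (measurableSet_singleton 0),
    ← off (S \ {0}) (hS.diff (measurableSet_singleton 0)) (by simp)]
  congr 2
  · ext x
    simp only [Set.mem_inter_iff, Set.mem_preimage, Set.mem_singleton_iff]
    constructor <;> rintro ⟨h, rfl⟩ <;> simpa using h
  · ext x
    simp

lemma charFun_eq_of_norm_eq (hf : IsUnimodalDensity m f) {ξ η : E d} (h : ‖ξ‖ = ‖η‖) :
    charFun m ξ = charFun m η := by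
  -- The reflection exchanging two vectors of equal length.
  set U := (ℝ ∙ (ξ - η))ᗮ.reflection with hU
  have hUξ : U ξ = η := Submodule.reflection_sub h
  have hm : AEMeasurable U m := U.continuous.measurable.aemeasurable
  rw [charFun_apply, charFun_apply, ← hUξ]
  conv_rhs => rw [← hf.map_linearIsometryEquiv U]
  rw [integral_map hm (by fun_prop)]
  simp

end IsUnimodalDensity

end Unimodal

/-! ### Characteristic functions: cosine means and masses of small balls. -/

section CharFun

variable {d : ℕ} {m : Measure (E d)} [IsProbabilityMeasure m]

lemma integral_one_sub_cos (ξ : E d) :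
    ∫ x, (1 - Real.cos (inner ℝ ξ x)) ∂m = 1 - (charFun m ξ).re := by
  have hc : ∫ x, Real.cos (inner ℝ ξ x) ∂m = (charFun m ξ).re := by
    rw [charFun_apply]
    change _ = RCLike.re (K := ℂ) _
    rw [← integral_re]
    · refine integral_congr_ae (ae_of_all _ fun x => ?_)
      simp [Complex.exp_ofReal_mul_I_re, real_inner_comm]
    · refine (integrable_const (1 : ℝ)).mono' (by fun_prop) (ae_of_all _ fun x => ?_)
      simp [Complex.norm_exp_ofReal_mul_I]
  rw [integral_sub (integrable_const _), hc]
  · simp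
  · refine (integrable_const (1 : ℝ)).mono' (by fun_prop) (ae_of_all _ fun x => ?_)
    simpa using Real.abs_cos_le_one _

lemma lintegral_one_sub_cos (ξ : E d) :
    ∫⁻ x, ENNReal.ofReal (1 - Real.cos (inner ℝ ξ x)) ∂m =
      ENNReal.ofReal (1 - (charFun m ξ).re) := by
  rw [← integral_one_sub_cos, ofReal_integral_eq_lintegral_ofReal]
  · refine (integrable_const (2 : ℝ)).mono' (by fun_prop) (ae_of_all _ fun x => ?_)
    rw [Real.norm_eq_abs, abs_le]
    constructor <;> linarith [Real.cos_le_one (inner ℝ ξ x), Real.neg_one_le_cos (inner ℝ ξ x)]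
  · exact ae_of_all _ fun x => by simpa using Real.cos_le_one _

/-- Fubini for the Gaussian Fourier transform. -/
lemma integral_gaussian_mul_charFun {b : ℝ} (hb : 0 < b) :
    ∫ ξ : E d, Complex.exp (-b * ‖ξ‖ ^ 2) * charFun m ξ =
      (Real.pi / b : ℂ) ^ (d / 2 : ℂ) * ∫ x, Complex.exp (-‖x‖ ^ 2 / (4 * b)) ∂m := by
  have hb' : 0 < (b : ℂ).re := by simpa using hb
  have hg : Integrable fun ξ : E d => Complex.exp (-b * ‖ξ‖ ^ 2) := by
    simpa using GaussianFourier.integrable_cexp_neg_mul_sq_norm_add hb' 0 (0 : E d)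
  have hint : Integrable (Function.uncurry fun (ξ x : E d) =>
      Complex.exp (-b * ‖ξ‖ ^ 2) * Complex.exp (inner ℝ x ξ * Complex.I)) (volume.prod m) := by
    refine (hg.comp_fst m).norm.mono' (by fun_prop) (ae_of_all _ fun z => ?_)
    simp [Function.uncurry, Complex.norm_exp_ofReal_mul_I]
  calc ∫ ξ : E d, Complex.exp (-b * ‖ξ‖ ^ 2) * charFun m ξ
      = ∫ ξ : E d, ∫ x, Complex.exp (-b * ‖ξ‖ ^ 2) * Complex.exp (inner ℝ x ξ * Complex.I) ∂m := by
        simp_rw [charFun_apply, integral_const_mul]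
    _ = ∫ x, (∫ ξ : E d, Complex.exp (-b * ‖ξ‖ ^ 2) * Complex.exp (inner ℝ x ξ * Complex.I)) ∂m :=
        integral_integral_swap hint
    _ = ∫ x, (Real.pi / b : ℂ) ^ (d / 2 : ℂ) * Complex.exp (-‖x‖ ^ 2 / (4 * b)) ∂m := by
        refine integral_congr_ae (ae_of_all _ fun x => ?_)
        have := GaussianFourier.integral_cexp_neg_mul_sq_norm_add hb' Complex.I x
        simp only [finrank_euclideanSpace_fin, Complex.I_sq] at this
        simp only [← Complex.exp_add]
        simp_rw [mul_comm _ Complex.I]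
        rw [this]
        ring_nf
    _ = _ := by rw [integral_const_mul]

/-- Small balls have mass at most a constant times their volume times `∫ |charFun|`. -/
lemma measureReal_norm_le_le (hφ : Integrable (charFun m)) {r : ℝ} (hr : 0 < r) :
    m.real {x | ‖x‖ ≤ r} ≤ Real.exp 1 * r ^ d * ∫ ξ, ‖charFun m ξ‖ := by
  -- With this b the Gaussian is exp(-‖x‖²/r²), at least 1/e on the ball of radius r.
  set b : ℝ := r ^ 2 / 4 with hbdef
  have hb : 0 < b := by positivity
  have hgi : Integrable (fun x : E d => Real.exp (-‖x‖ ^ 2 / (4 * b))) m := by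
    refine (integrable_const (1 : ℝ)).mono' (by fun_prop) (ae_of_all _ fun x => ?_)
    rw [Real.norm_eq_abs, Real.abs_exp, Real.exp_le_one_iff]
    exact div_nonpos_of_nonpos_of_nonneg (by simp) (by positivity)
  have h1 : Real.exp (-1) * m.real {x | ‖x‖ ≤ r} ≤ ∫ x, Real.exp (-‖x‖ ^ 2 / (4 * b)) ∂m := by
    have hS : MeasurableSet {x : E d | ‖x‖ ≤ r} := measurableSet_le measurable_norm measurable_const
    rw [mul_comm, ← smul_eq_mul, ← setIntegral_const]
    refine (setIntegral_mono_on (integrable_const _).integrableOn hgi.integrableOn hS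
      fun x hx => ?_).trans (setIntegral_le_integral hgi (ae_of_all _ fun x => (Real.exp_pos _).le))
    apply Real.exp_le_exp.2
    rw [le_div_iff₀ (by positivity)]
    have : ‖x‖ ^ 2 ≤ r ^ 2 := by gcongr; exact hx
    rw [hbdef]; linarith
  have h2 : ‖∫ x, Complex.exp (-‖x‖ ^ 2 / (4 * b)) ∂m‖ =
      ∫ x, Real.exp (-‖x‖ ^ 2 / (4 * b)) ∂m := by
    have : ∀ x : E d, Complex.exp (-‖x‖ ^ 2 / (4 * b)) =
        ((Real.exp (-‖x‖ ^ 2 / (4 * b)) : ℝ) : ℂ) := by intro x; push_cast; rfl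
    simp_rw [this]
    rw [integral_complex_ofReal, Complex.norm_real, Real.norm_of_nonneg]
    exact integral_nonneg fun x => (Real.exp_pos _).le
  have h3 : ‖(Real.pi / b : ℂ) ^ (d / 2 : ℂ)‖ = (Real.pi / b) ^ (d / 2 : ℝ) := by
    have : (Real.pi / b : ℂ) ^ (d / 2 : ℂ) = (((Real.pi / b) ^ (d / 2 : ℝ) : ℝ) : ℂ) := by
      rw [Complex.ofReal_cpow (by positivity)]; push_cast; rfl
    rw [this, Complex.norm_real, Real.norm_of_nonneg (by positivity)]
  have h4 : ‖∫ ξ : E d, Complex.exp (-b * ‖ξ‖ ^ 2) * charFun m ξ‖ ≤ ∫ ξ, ‖charFun m ξ‖ := by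
    refine norm_integral_le_of_norm_le hφ.norm (ae_of_all _ fun ξ => ?_)
    rw [norm_mul]
    refine mul_le_of_le_one_left (norm_nonneg _) ?_
    rw [Complex.norm_exp, Real.exp_le_one_iff]
    have : (-b * ‖ξ‖ ^ 2 : ℂ) = ((-b * ‖ξ‖ ^ 2 : ℝ) : ℂ) := by push_cast; rfl
    rw [this, Complex.ofReal_re]
    nlinarith [sq_nonneg ‖ξ‖]
  rw [integral_gaussian_mul_charFun hb, norm_mul, h2, h3] at h4
  -- The product is (4π)^(d/2); it is simply discarded.
  have h5 : 1 ≤ r ^ d * (Real.pi / b) ^ (d / 2 : ℝ) := by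
    have : r ^ d = (r ^ 2) ^ (d / 2 : ℝ) := by
      rw [← Real.rpow_natCast r 2, ← Real.rpow_mul hr.le, ← Real.rpow_natCast]
      congr 1; push_cast; ring
    rw [this, ← Real.mul_rpow (by positivity) (by positivity)]
    apply Real.one_le_rpow _ (by positivity)
    rw [hbdef]
    field_simp
    linarith [Real.pi_gt_three]
  set A := ∫ x, Real.exp (-‖x‖ ^ 2 / (4 * b)) ∂m with hA
  have hA0 : 0 ≤ A := integral_nonneg fun x => (Real.exp_pos _).le
  calc m.real {x | ‖x‖ ≤ r} = Real.exp 1 * (Real.exp (-1) * m.real {x | ‖x‖ ≤ r}) := by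
        rw [← mul_assoc, ← Real.exp_add]; simp
    _ ≤ Real.exp 1 * A := by gcongr
    _ ≤ Real.exp 1 * ((r ^ d * (Real.pi / b) ^ (d / 2 : ℝ)) * A) := by
        gcongr; exact le_mul_of_one_le_left hA0 h5
    _ = Real.exp 1 * r ^ d * ((Real.pi / b) ^ (d / 2 : ℝ) * A) := by ring
    _ ≤ _ := by gcongr

end CharFun

/-! ### The maximal function and its generalized inverse. -/

section MaximalFunction

variable {φ : ℝ → ℝ}

lemma bddAbove_image_Icc (hφ : Continuous φ) (u : ℝ) : BddAbove (φ '' Set.Icc 0 u) :=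
  (isCompact_Icc.image hφ).bddAbove

lemma le_maximalFunction (hφ : Continuous φ) {s u : ℝ} (hs : 0 ≤ s) (hsu : s ≤ u) :
    φ s ≤ maximalFunction φ u :=
  le_csSup (bddAbove_image_Icc hφ u) ⟨s, ⟨hs, hsu⟩, rfl⟩

lemma exists_eq_maximalFunction (hφ : Continuous φ) {u : ℝ} (hu : 0 ≤ u) :
    ∃ s, 0 ≤ s ∧ s ≤ u ∧ φ s = maximalFunction φ u := by
  obtain ⟨s, hs, h⟩ := (isCompact_Icc.image hφ).sSup_mem
    ((Set.nonempty_Icc.2 hu).image φ)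
  exact ⟨s, hs.1, hs.2, h⟩

lemma maximalFunction_mono (hφ : Continuous φ) {u v : ℝ} (hu : 0 ≤ u) (huv : u ≤ v) :
    maximalFunction φ u ≤ maximalFunction φ v := by
  obtain ⟨s, hs, hsu, h⟩ := exists_eq_maximalFunction hφ hu
  exact h ▸ le_maximalFunction hφ hs (hsu.trans huv)

/-- For a continuous unbounded function the generalized inverse of the maximal function is the
first point at which the level is attained. -/
lemma exists_genInverse_eq (hφ : Continuous φ) (h0 : φ 0 = 0) {v : ℝ} (hv : 0 < v)
    (hex : ∃ s, 0 ≤ s ∧ v ≤ φ s) :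
    ∃ u, 0 < u ∧ genInverse (maximalFunction φ) v = ENNReal.ofReal u ∧ φ u = v ∧
      maximalFunction φ u = v := by
  set A : Set ℝ := Set.Ici 0 ∩ φ ⁻¹' Set.Ici v with hA
  have hAc : IsClosed A := isClosed_Ici.inter (isClosed_Ici.preimage hφ)
  have hAb : BddBelow A := ⟨0, fun s hs => hs.1⟩
  have hAn : A.Nonempty := hex
  have huA : sInf A ∈ A := hAc.csInf_mem hAn hAb
  set u := sInf A with hu
  have hlt : ∀ s, 0 ≤ s → s < u → φ s < v := by
    intro s hs hsu
    by_contra hcon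
    exact absurd (csInf_le hAb ⟨hs, not_lt.1 hcon⟩) (not_le.2 hsu)
  have hu0 : 0 ≤ u := huA.1
  have huv : v ≤ φ u := huA.2
  have hφu : φ u = v := by
    obtain ⟨s, hs, hsv⟩ := intermediate_value_Icc hu0 hφ.continuousOn
      (show v ∈ Set.Icc (φ 0) (φ u) from ⟨by rw [h0]; exact hv.le, huv⟩)
    rcases hs.2.eq_or_lt with rfl | hlt'
    · exact hsv
    · exact absurd hsv (hlt s hs.1 hlt').ne
  have hupos : 0 < u := by
    rcases hu0.eq_or_lt with h | h
    · rw [← h, h0] at hφu; exact absurd hφu hv.ne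
    · exact h
  have hmax : maximalFunction φ u = v := by
    obtain ⟨s, hs, hsu, h⟩ := exists_eq_maximalFunction hφ hu0
    refine le_antisymm ?_ (hφu ▸ le_maximalFunction hφ hu0 le_rfl)
    rw [← h]
    rcases hsu.eq_or_lt with rfl | hlt'
    · exact hφu.le
    · exact (hlt s hs hlt').le
  refine ⟨u, hupos, ?_, hφu, hmax⟩
  apply le_antisymm
  · refine iInf₂_le_of_le ⟨u, hu0⟩ hmax.ge ?_
    rw [ENNReal.ofReal_eq_coe_nnreal hu0]
    exact le_rfl
  · refine le_iInf₂ fun s hs => ?_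
    rw [← ENNReal.ofReal_coe_nnreal]
    apply ENNReal.ofReal_le_ofReal
    by_contra hcon
    obtain ⟨r, hr, hrs, h⟩ := exists_eq_maximalFunction hφ s.2
    have := hlt r hr (hrs.trans_lt (not_le.1 hcon))
    rw [h] at this
    exact absurd hs (not_le.2 this)

end MaximalFunction

/-! ### The Lévy–Khintchine exponent: integrability, doubling, vanishing. -/

section Exponent

variable {d : ℕ} {ν : Measure (E d)}

lemma one_sub_cos_le_mul_min (ξ x : E d) :
    1 - Real.cos (inner ℝ ξ x) ≤ (‖ξ‖ ^ 2 + 2) * min (‖x‖ ^ 2) 1 := by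
  have h1 : 1 - Real.cos (inner ℝ ξ x) ≤ ‖ξ‖ ^ 2 * ‖x‖ ^ 2 := by
    have := Real.one_sub_sq_div_two_le_cos (x := inner ℝ ξ x)
    have h2 : (inner ℝ ξ x) ^ 2 ≤ (‖ξ‖ * ‖x‖) ^ 2 := by
      rw [← sq_abs]; gcongr; exact abs_real_inner_le_norm ξ x
    nlinarith [sq_nonneg (inner ℝ ξ x)]
  have h2 := Real.neg_one_le_cos (inner ℝ ξ x)
  rcases min_cases (‖x‖ ^ 2) 1 with ⟨h, _⟩ | ⟨h, _⟩ <;> rw [h] <;>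
    nlinarith [sq_nonneg ‖ξ‖, sq_nonneg ‖x‖]

lemma IsLevyMeasure.integrable_one_sub_cos (hν : IsLevyMeasure ν) (ξ : E d) :
    Integrable (fun x => 1 - Real.cos (inner ℝ ξ x)) ν := by
  have hmin : Integrable (fun x : E d => min (‖x‖ ^ 2) 1) ν := by
    refine ⟨by fun_prop, ?_⟩
    rw [hasFiniteIntegral_iff_ofReal (ae_of_all _ fun x => by positivity)]
    exact hν.lintegral_lt_top
  refine (hmin.const_mul (‖ξ‖ ^ 2 + 2)).mono' (by fun_prop) (ae_of_all _ fun x => ?_)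
  rw [Real.norm_of_nonneg (by linarith [Real.cos_le_one (inner ℝ ξ x)])]
  exact one_sub_cos_le_mul_min ξ x

lemma levyExponent_nonneg (ξ : E d) : 0 ≤ levyExponent ν ξ :=
  integral_nonneg fun x => by simpa using Real.cos_le_one _

/-- Pointwise, 1 - cos 2y = 4(1 - cos y) - 2(1 - cos y)². This doubling supplies every scale change
that is made without a scaling hypothesis. -/
lemma IsLevyMeasure.levyExponent_two_smul_le (hν : IsLevyMeasure ν) (ξ : E d) :
    levyExponent ν ((2 : ℝ) • ξ) ≤ 4 * levyExponent ν ξ := by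
  rw [levyExponent, levyExponent, ← integral_const_mul]
  refine integral_mono (hν.integrable_one_sub_cos _) ((hν.integrable_one_sub_cos _).const_mul _)
    fun x => ?_
  simp only [inner_smul_left, conj_trivial, Real.cos_two_mul]
  nlinarith [sq_nonneg (1 - Real.cos (inner ℝ ξ x))]

/-- If the exponent vanishes at two incommensurable multiples of a nonzero `ξ`, then `ν` does not
charge the complement of the hyperplane orthogonal to `ξ`. -/
lemma IsLevyMeasure.ae_inner_eq_zero (hν : IsLevyMeasure ν) {ξ : E d}
    (h1 : levyExponent ν ξ = 0) (h2 : levyExponent ν (√2 • ξ) = 0) :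
    ∀ᵐ x ∂ν, inner ℝ ξ x = (0 : ℝ) := by
  have key : ∀ ζ, levyExponent ν ζ = 0 → ∀ᵐ x ∂ν, Real.cos (inner ℝ ζ x) = 1 := by
    intro ζ hζ
    have := (integral_eq_zero_iff_of_nonneg (fun x => by simpa using Real.cos_le_one _)
      (hν.integrable_one_sub_cos ζ)).1 hζ
    filter_upwards [this] with x hx
    simp only [Pi.zero_apply] at hx
    linarith
  filter_upwards [key _ h1, key _ h2] with x hx1 hx2
  rw [inner_smul_left, conj_trivial] at hx2
  obtain ⟨n, hn⟩ := (Real.cos_eq_one_iff _).1 hx1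
  obtain ⟨k, hk⟩ := (Real.cos_eq_one_iff _).1 hx2
  rw [← hn] at hk ⊢
  rcases eq_or_ne n 0 with rfl | hn0
  · simp
  exfalso
  have hpi := Real.pi_pos
  have hk' : (k : ℝ) = √2 * n := by
    have : (k : ℝ) * (2 * Real.pi) = (√2 * n) * (2 * Real.pi) := by rw [hk]; ring
    exact mul_right_cancel₀ (by positivity) this
  exact (irrational_sqrt_two.mul_intCast hn0).ne_int k hk'.symm

end Exponent

/-! ### The process: regularity of ψ and tail estimates. -/

section LevyProcess

variable {d : ℕ} {Ω : Type*} [MeasurableSpace Ω] {P : Measure Ω}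
  {X : ℝ≥0 → Ω → E d} {ν : Measure (E d)}

namespace IsPureJumpUnimodalLevyProcess

lemma charFun_eq_ofReal (h : IsPureJumpUnimodalLevyProcess P X ν) (t : ℝ≥0) (ξ : E d) :
    charFun (P.map (X t)) ξ = ((Real.exp (-(t * levyExponent ν ξ)) : ℝ) : ℂ) := by
  rw [h.charFun_eq]; push_cast; rfl

/-- Transfers continuity and radiality from the law of `X 1` to ψ, so that no isotropy of ν has to
be established. -/
lemma levyExponent_eq_neg_log (h : IsPureJumpUnimodalLevyProcess P X ν) (ξ : E d) :
    levyExponent ν ξ = -Real.log (charFun (P.map (X 1)) ξ).re := by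
  rw [h.charFun_eq_ofReal, Complex.ofReal_re, Real.log_exp]; simp

lemma isProbabilityMeasure_map [IsProbabilityMeasure P]
    (h : IsPureJumpUnimodalLevyProcess P X ν) (t : ℝ≥0) :
    IsProbabilityMeasure (P.map (X t)) :=
  Measure.isProbabilityMeasure_map (h.measurable t).aemeasurable

lemma continuous_levyExponent [IsProbabilityMeasure P]
    (h : IsPureJumpUnimodalLevyProcess P X ν) :
    Continuous (levyExponent ν) := by
  have := h.isProbabilityMeasure_map 1
  rw [funext h.levyExponent_eq_neg_log]
  refine Continuous.neg (Continuous.log (Complex.continuous_re.comp continuous_charFun) fun ξ => ?_)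
  rw [h.charFun_eq_ofReal, Complex.ofReal_re]
  exact (Real.exp_pos _).ne'

end IsPureJumpUnimodalLevyProcess

variable [NeZero d]

lemma single_eq_smul (u : ℝ) :
    EuclideanSpace.single (0 : Fin d) u = u • EuclideanSpace.single (0 : Fin d) (1 : ℝ) := by
  ext i
  rcases eq_or_ne i 0 with rfl | hi <;> simp [*]

lemma radialExponent_nonneg (u : ℝ) : 0 ≤ radialExponent ν u := levyExponent_nonneg _

lemma radialExponent_zero : radialExponent ν 0 = 0 := by
  rw [radialExponent, single_eq_smul]
  simp [levyExponent]

namespace IsPureJumpUnimodalLevyProcess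

lemma levyExponent_eq (h : IsPureJumpUnimodalLevyProcess P X ν) (ξ : E d) :
    levyExponent ν ξ = radialExponent ν ‖ξ‖ := by
  obtain ⟨f, hf⟩ := h.unimodal 1
  rw [radialExponent, h.levyExponent_eq_neg_log, h.levyExponent_eq_neg_log,
    hf.charFun_eq_of_norm_eq (η := EuclideanSpace.single 0 ‖ξ‖) (by simp)]

lemma radialExponent_two_mul_le (h : IsPureJumpUnimodalLevyProcess P X ν) (u : ℝ) :
    radialExponent ν (2 * u) ≤ 4 * radialExponent ν u := by
  have := h.levyMeasure.levyExponent_two_smul_le (EuclideanSpace.single (0 : Fin d) u)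
  rwa [single_eq_smul, smul_smul, ← single_eq_smul, ← single_eq_smul] at this

lemma radialExponent_two_pow_mul_le (h : IsPureJumpUnimodalLevyProcess P X ν) (k : ℕ) (u : ℝ) :
    radialExponent ν (2 ^ k * u) ≤ 4 ^ k * radialExponent ν u := by
  induction k with
  | zero => simp
  | succ k ih =>
    calc radialExponent ν (2 ^ (k + 1) * u) = radialExponent ν (2 * (2 ^ k * u)) := by ring_nf
      _ ≤ 4 * radialExponent ν (2 ^ k * u) := h.radialExponent_two_mul_le _
      _ ≤ 4 * (4 ^ k * radialExponent ν u) := by gcongr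
      _ = 4 ^ (k + 1) * radialExponent ν u := by ring

/-- Lower scaling is vacuous where ψ vanishes; a positive value beyond θ is what makes it force ψ to
infinity. If there were none, vanishing at η and √2 η along each coordinate axis would concentrate ν
at the origin, contradicting ν ≠ 0. -/
lemma exists_radialExponent_pos (h : IsPureJumpUnimodalLevyProcess P X ν) (θ : ℝ) :
    ∃ η, θ < η ∧ 0 < η ∧ 0 < radialExponent ν η := by
  by_contra! hcon
  have hzero : ∀ η, θ < η → 0 < η → radialExponent ν η = 0 := fun η h1 h2 =>
    le_antisymm (hcon η h1 h2) (radialExponent_nonneg η)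
  set η := max θ 0 + 1 with hη
  have hη1 : θ < η := by linarith [le_max_left θ 0]
  have hη2 : 0 < η := by linarith [le_max_right θ 0]
  have hs : 1 ≤ √2 := Real.one_le_sqrt.2 (by norm_num)
  have hη3 : η ≤ √2 * η := le_mul_of_one_le_left hη2.le hs
  have hcoord : ∀ i : Fin d, ∀ᵐ x ∂ν, x i = 0 := by
    intro i
    have h1 : levyExponent ν (EuclideanSpace.single i η) = 0 := by
      rw [h.levyExponent_eq, PiLp.norm_single, Real.norm_of_nonneg hη2.le, hzero η hη1 hη2]
    have h2 : levyExponent ν (√2 • EuclideanSpace.single i η) = 0 := by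
      rw [h.levyExponent_eq, norm_smul, PiLp.norm_single, Real.norm_of_nonneg hη2.le,
        Real.norm_of_nonneg (by positivity), hzero _ (hη1.trans_le hη3) (hη2.trans_le hη3)]
    filter_upwards [h.levyMeasure.ae_inner_eq_zero h1 h2] with x hx
    rw [EuclideanSpace.inner_single_left] at hx
    simpa [hη2.ne'] using hx
  have hall : ∀ᵐ x ∂ν, x = 0 := by
    filter_upwards [ae_all_iff.2 hcoord] with x hx
    ext i; simpa using hx i
  apply h.levyMeasure_ne_zero
  rw [← Measure.measure_univ_eq_zero]
  have h1 : ν {0}ᶜ = 0 := hall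
  rw [← Set.union_compl_self {(0 : E d)}]
  exact measure_union_null h.levyMeasure.zero_singleton h1

variable [IsProbabilityMeasure P]

lemma continuous_radialExponent (h : IsPureJumpUnimodalLevyProcess P X ν) :
    Continuous (radialExponent ν) := by
  refine h.continuous_levyExponent.comp ?_
  rw [funext (single_eq_smul (d := d))]
  fun_prop

/-- Doubling passes to ψ* by applying it at a maximizer, scaled back by 2^k into [0, u]. -/
lemma psiStar_two_pow_mul_le (h : IsPureJumpUnimodalLevyProcess P X ν) (k : ℕ) {u : ℝ}
    (hu : 0 ≤ u) : psiStar ν (2 ^ k * u) ≤ 4 ^ k * psiStar ν u := by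
  obtain ⟨s, hs, hsu, hse⟩ :=
    exists_eq_maximalFunction h.continuous_radialExponent (u := 2 ^ k * u) (by positivity)
  calc psiStar ν (2 ^ k * u) = radialExponent ν (2 ^ k * (s / 2 ^ k)) := by
        rw [mul_div_cancel₀ _ (by positivity)]; exact hse.symm
    _ ≤ 4 ^ k * radialExponent ν (s / 2 ^ k) := h.radialExponent_two_pow_mul_le _ _
    _ ≤ 4 ^ k * psiStar ν u := by
        gcongr
        refine le_maximalFunction h.continuous_radialExponent (by positivity) ?_
        rw [div_le_iff₀ (by positivity)]; linarith

/-- Under lower scaling `ψ⁻(1/t)` is finite and is the first point at which `ψ` equals `1/t`. -/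
lemma exists_psiInv_eq (h : IsPureJumpUnimodalLevyProcess P X ν) {α θ c : ℝ} (hα : 0 < α)
    (hc : 0 < c) (hψ : WLSC (radialExponent ν) α θ c) {t : ℝ≥0} (ht : 0 < t) :
    ∃ u, 0 < u ∧ psiInv ν (1 / t) = ENNReal.ofReal u ∧ t * radialExponent ν u = 1 ∧
      t * psiStar ν u = 1 := by
  have ht' : 0 < (t : ℝ) := ht
  obtain ⟨η, hη, hη0, hpos⟩ := h.exists_radialExponent_pos θ
  have hlim : Tendsto (fun l : ℝ => c * l ^ α * radialExponent ν η) atTop atTop :=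
    ((tendsto_rpow_atTop hα).const_mul_atTop hc).atTop_mul_const hpos
  obtain ⟨l, hl, hl1⟩ :=
    ((hlim.eventually_ge_atTop (1 / (t : ℝ))).and (eventually_ge_atTop 1)).exists
  obtain ⟨u, hu, h1, h2, h3⟩ := exists_genInverse_eq h.continuous_radialExponent
    radialExponent_zero (v := 1 / (t : ℝ)) (by positivity)
    ⟨l * η, by positivity, hl.trans (hψ l η hl1 hη)⟩
  refine ⟨u, hu, h1, ?_, ?_⟩
  · rw [h2]; field_simp
  · rw [psiStar, h3]; field_simp

lemma lintegral_one_sub_cos (h : IsPureJumpUnimodalLevyProcess P X ν) (t : ℝ≥0) (ξ : E d) :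
    ∫⁻ x, ENNReal.ofReal (1 - Real.cos (inner ℝ ξ x)) ∂(P.map (X t)) =
      ENNReal.ofReal (1 - Real.exp (-(t * radialExponent ν ‖ξ‖))) := by
  have := h.isProbabilityMeasure_map t
  rw [UnimodalLevy.lintegral_one_sub_cos, h.charFun_eq_ofReal, Complex.ofReal_re,
    h.levyExponent_eq]

/-- The half-space inequality at ±u e_i, together with 1 - exp(-T) ≤ T. -/
lemma measure_abs_coord_le (h : IsPureJumpUnimodalLevyProcess P X ν) (t : ℝ≥0) {u : ℝ}
    (hu : 0 < u) (i : Fin d) :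
    P.map (X t) {x | Real.pi ≤ u * |x i|} ≤ ENNReal.ofReal (2 * (t * radialExponent ν u)) := by
  obtain ⟨f, hf⟩ := h.unimodal t
  have half : ∀ v : ℝ, |v| = u → P.map (X t) {x | Real.pi ≤ v * x i} ≤
      ENNReal.ofReal (t * radialExponent ν u) := by
    intro v hv
    have hv0 : v ≠ 0 := by rintro rfl; simp at hv; exact hu.ne hv
    have := hf.measure_halfspace_le (ξ := EuclideanSpace.single i v) (by simpa using hv0)
    rw [h.lintegral_one_sub_cos] at this
    simp only [EuclideanSpace.inner_single_left, PiLp.norm_single, Real.norm_eq_abs, hv,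
      conj_trivial] at this
    refine this.trans (ENNReal.ofReal_le_ofReal ?_)
    linarith [Real.one_sub_le_exp_neg (t * radialExponent ν u)]
  have hsub : {x : E d | Real.pi ≤ u * |x i|} ⊆
      {x | Real.pi ≤ u * x i} ∪ {x | Real.pi ≤ (-u) * x i} := by
    intro x hx
    simp only [Set.mem_ofPred_eq, Set.mem_union] at hx ⊢
    rcases abs_cases (x i) with ⟨hh, _⟩ | ⟨hh, _⟩ <;> rw [hh] at hx
    · exact Or.inl hx
    · exact Or.inr (by linarith)
  have h0 : 0 ≤ t * radialExponent ν u := mul_nonneg t.coe_nonneg (radialExponent_nonneg u)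
  refine (measure_mono hsub).trans ((measure_union_le _ _).trans ?_)
  rw [two_mul, ENNReal.ofReal_add h0 h0]
  exact add_le_add (half u (abs_of_pos hu)) (half (-u) (by rw [abs_neg, abs_of_pos hu]))

lemma measure_norm_le (h : IsPureJumpUnimodalLevyProcess P X ν) (t : ℝ≥0) {u : ℝ}
    (hu : 0 < u) :
    P.map (X t) {x | d * Real.pi ≤ u * ‖x‖} ≤
      ENNReal.ofReal (2 * d * (t * radialExponent ν u)) := by
  have hsub : {x : E d | d * Real.pi ≤ u * ‖x‖} ⊆ ⋃ i, {x | Real.pi ≤ u * |x i|} := by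
    intro x hx
    by_contra hcon
    simp only [Set.mem_iUnion, Set.mem_ofPred_eq, not_exists, not_le] at hcon hx
    have hnorm : ‖x‖ ≤ ∑ i, |x i| := by
      calc ‖x‖ = ‖∑ i, EuclideanSpace.single i (x i)‖ := by
            congr 1; ext j; simp
        _ ≤ ∑ i, ‖EuclideanSpace.single i (x i)‖ := norm_sum_le _ _
        _ = ∑ i, |x i| := by simp
    have : u * ∑ i, |x i| < d * Real.pi := by
      rw [Finset.mul_sum]
      calc ∑ i, u * |x i| < ∑ _i : Fin d, Real.pi :=
            Finset.sum_lt_sum_of_nonempty Finset.univ_nonempty fun i _ => hcon i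
        _ = d * Real.pi := by simp
    nlinarith
  refine (measure_mono hsub).trans ((measure_iUnion_le _).trans ?_)
  rw [tsum_fintype]
  refine (Finset.sum_le_sum fun i _ => h.measure_abs_coord_le t hu i).trans ?_
  rw [Finset.sum_const, Finset.card_univ, Fintype.card_fin, nsmul_eq_mul,
    ← ENNReal.ofReal_natCast, ← ENNReal.ofReal_mul (by positivity)]
  exact (congrArg ENNReal.ofReal (by ring)).le

end IsPureJumpUnimodalLevyProcess

/-- The tail estimate `P(|X_t| ≥ R) ≤ C t ψ(1/R)` with a dimensional constant. -/
lemma exists_tail_bound (d : ℕ) [NeZero d] :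
    ∃ B : ℝ, 0 < B ∧ ∀ {Ω : Type*} [MeasurableSpace Ω] {P : Measure Ω} [IsProbabilityMeasure P]
      {X : ℝ≥0 → Ω → E d} {ν : Measure (E d)}, IsPureJumpUnimodalLevyProcess P X ν →
      ∀ (t : ℝ≥0) {R : ℝ}, 0 < R →
        P.map (X t) {x | R ≤ ‖x‖} ≤ ENNReal.ofReal (B * (t * radialExponent ν (1 / R))) := by
  -- Raising the frequency from 1/R to 2^k/R absorbs the factor dπ of `measure_norm_le`; doubling
  -- charges 4^k, a dimensional constant.
  obtain ⟨k, hk⟩ := pow_unbounded_of_one_lt (d * Real.pi) (one_lt_two (α := ℝ))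
  have hd : 0 < d := Nat.pos_of_ne_zero (NeZero.ne d)
  refine ⟨2 * d * 4 ^ k, by positivity, fun {Ω} _ {P} _ {X ν} h t R hR => ?_⟩
  have hsub : {x : E d | R ≤ ‖x‖} ⊆ {x | d * Real.pi ≤ (2 ^ k * (1 / R)) * ‖x‖} := by
    intro x hx
    have : 1 ≤ (1 / R) * ‖x‖ := by rw [one_div_mul_eq_div, one_le_div hR]; exact hx
    simp only [Set.mem_ofPred_eq]
    rw [mul_assoc]
    nlinarith [pow_pos (two_pos (α := ℝ)) k]
  refine (measure_mono hsub).trans ((h.measure_norm_le t (by positivity)).trans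
    (ENNReal.ofReal_le_ofReal ?_))
  calc 2 * d * (t * radialExponent ν (2 ^ k * (1 / R)))
      ≤ 2 * d * (t * (4 ^ k * radialExponent ν (1 / R))) := by
        gcongr; exact h.radialExponent_two_pow_mul_le k _
    _ = _ := by ring

end LevyProcess

/-! ### The upper bound. -/

section Upper

lemma volumeReal_ball_pos (d : ℕ) : 0 < volume.real (Metric.ball (0 : E d) 1) :=
  ENNReal.toReal_pos (Metric.measure_ball_pos _ _ one_pos).ne' measure_ball_lt_top.ne

lemma integrable_exp_neg_mul_norm_rpow (d : ℕ) [NeZero d] {α c : ℝ} (hα : 0 < α) (hc : 0 < c) :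
    Integrable fun z : E d => Real.exp (-c * ‖z‖ ^ α) := by
  have hd : 0 < d := Nat.pos_of_ne_zero (NeZero.ne d)
  refine (integrable_fun_norm_addHaar (volume : Measure (E d))
    (f := fun y : ℝ => Real.exp (-c * y ^ α))).2 ?_
  refine (integrableOn_rpow_mul_exp_neg_mul_rpow (p := α) (s := (d - 1 : ℕ)) (b := c) ?_ hα
    hc).congr_fun (fun y _ => ?_) measurableSet_Ioi
  · have : (0 : ℝ) ≤ (d - 1 : ℕ) := Nat.cast_nonneg _
    linarith
  · simp

/-- Under lower scaling the characteristic function of `X_t` is integrable and its `L¹` norm is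
comparable with the volume of the ball of radius `ψ⁻(1/t)`. -/
lemma exists_integral_norm_charFun_le (d : ℕ) [NeZero d] {α c : ℝ} (hα : 0 < α) (hc : 0 < c) :
    ∃ J : ℝ, 0 ≤ J ∧ ∀ {Ω : Type*} [MeasurableSpace Ω] {P : Measure Ω} [IsProbabilityMeasure P]
      {X : ℝ≥0 → Ω → E d} {ν : Measure (E d)}, IsPureJumpUnimodalLevyProcess P X ν →
      ∀ {θ u : ℝ} {t : ℝ≥0}, WLSC (radialExponent ν) α θ c → θ < u → 0 < u →
        t * radialExponent ν u = 1 →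
        Integrable (charFun (P.map (X t))) ∧ ∫ ξ, ‖charFun (P.map (X t)) ξ‖ ≤ J * u ^ d := by
  -- An integrable majorant in the variable ξ/u. The factor e^c makes G ≥ 1 on the unit ball, where
  -- |charFun| ≤ 1 is all that is used; outside, scaling from u and tψ(u) = 1 give the decay.
  set G : E d → ℝ := fun z => Real.exp c * Real.exp (-c * ‖z‖ ^ α) with hG
  have hGi : Integrable G := (integrable_exp_neg_mul_norm_rpow d hα hc).const_mul _
  refine ⟨∫ z, G z, integral_nonneg fun z => by positivity,
    fun {Ω} _ {P} _ {X ν} h {θ u t} hψ hθu hu htu => ?_⟩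
  have := h.isProbabilityMeasure_map t
  have hGu : Integrable fun ξ : E d => G (u⁻¹ • ξ) := hGi.comp_smul (inv_ne_zero hu.ne')
  have hle : ∀ ξ : E d, ‖charFun (P.map (X t)) ξ‖ ≤ G (u⁻¹ • ξ) := by
    intro ξ
    rw [h.charFun_eq_ofReal, Complex.norm_real, Real.norm_of_nonneg (Real.exp_pos _).le,
      h.levyExponent_eq, hG]
    simp only
    rw [← Real.exp_add, norm_smul, norm_inv, Real.norm_of_nonneg hu.le]
    apply Real.exp_le_exp.2
    rcases le_total ‖ξ‖ u with hξ | hξ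
    · have h1 : (u⁻¹ * ‖ξ‖) ^ α ≤ 1 := Real.rpow_le_one (by positivity)
        (by rw [inv_mul_le_iff₀ hu, mul_one]; exact hξ) hα.le
      have h2 := mul_nonneg t.coe_nonneg (radialExponent_nonneg (ν := ν) ‖ξ‖)
      change 0 ≤ (t : ℝ) * _ at h2
      nlinarith
    · have h1 := hψ (u⁻¹ * ‖ξ‖) u (by rw [← div_eq_inv_mul, one_le_div hu]; exact hξ) hθu
      rw [show u⁻¹ * ‖ξ‖ * u = ‖ξ‖ by field_simp] at h1
      have h2 : t * (c * (u⁻¹ * ‖ξ‖) ^ α * radialExponent ν u) ≤ t * radialExponent ν ‖ξ‖ := by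
        gcongr
      rw [show t * (c * (u⁻¹ * ‖ξ‖) ^ α * radialExponent ν u) =
        c * (u⁻¹ * ‖ξ‖) ^ α * (t * radialExponent ν u) by ring, htu] at h2
      linarith
  have hi : Integrable (charFun (P.map (X t))) :=
    hGu.mono' continuous_charFun.aestronglyMeasurable (ae_of_all _ hle)
  refine ⟨hi, (integral_mono hi.norm hGu hle).trans (le_of_eq ?_)⟩
  rw [Measure.integral_comp_inv_smul_of_nonneg _ _ hu.le, finrank_euclideanSpace_fin, smul_eq_mul,
    mul_comm]

variable {d : ℕ} [NeZero d] {m : Measure (E d)} [IsFiniteMeasure m] {f : E d → ℝ≥0∞}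

/-- A bound on the mass of an annulus is a bound on a unimodal density. -/
lemma IsUnimodalDensity.le_ofReal (hf : IsUnimodalDensity m f) {x : E d} (hx : x ≠ 0) {M : ℝ}
    (hM : m.real {y | ‖x‖ / 2 ≤ ‖y‖ ∧ ‖y‖ ≤ ‖x‖} ≤ M) :
    f x ≤ ENNReal.ofReal (4 ^ d / volume.real (Metric.ball (0 : E d) 1) * (M / ‖x‖ ^ d)) := by
  have hx0 : 0 < ‖x‖ := norm_pos_iff.2 hx
  have hv : 0 < volume.real (Metric.ball (0 : E d) 1) := volumeReal_ball_pos d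
  have h1 := hf.le_measure_annulus hx
  rw [← ofReal_measureReal (s := Metric.ball (0 : E d) 1) measure_ball_lt_top.ne,
    ← ENNReal.ofReal_mul (by positivity), ← ofReal_measureReal (μ := m)] at h1
  rw [← ENNReal.le_div_iff_mul_le (Or.inl (by simpa using by positivity)) (Or.inl (by simp)),
    ← ENNReal.ofReal_div_of_pos (by positivity)] at h1
  refine h1.trans (ENNReal.ofReal_le_ofReal ?_)
  rw [show 4 ^ d / volume.real (Metric.ball (0 : E d) 1) * (M / ‖x‖ ^ d) =
    M / ((‖x‖ / 4) ^ d * volume.real (Metric.ball (0 : E d) 1)) by rw [div_pow]; field_simp]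
  gcongr

theorem exists_upper_bound (d : ℕ) [NeZero d] {α c : ℝ} (hα : 0 < α) (hc : 0 < c) :
    ∃ Cstar : ℝ, 0 < Cstar ∧ ∀ {Ω : Type*} [MeasurableSpace Ω] {P : Measure Ω}
      [IsProbabilityMeasure P] {X : ℝ≥0 → Ω → E d} {ν : Measure (E d)},
      IsPureJumpUnimodalLevyProcess P X ν → ∀ {θ : ℝ}, 0 ≤ θ → WLSC (radialExponent ν) α θ c →
      ∀ {t : ℝ≥0}, 0 < t → t * psiStar ν θ < 1 → ∀ {f : E d → ℝ≥0∞},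
      IsUnimodalDensity (P.map (X t)) f → ∀ x, f x ≤ ENNReal.ofReal Cstar * commonBound ν t x := by
  obtain ⟨J, hJ, hint⟩ := exists_integral_norm_charFun_le d hα hc
  obtain ⟨B, hB, htail⟩ := exists_tail_bound d
  set v := volume.real (Metric.ball (0 : E d) 1) with hvdef
  have hv : 0 < v := volumeReal_ball_pos d
  set C₁ := 4 ^ d / v * (Real.exp 1 * J) with hC₁
  set C₂ := 4 ^ d / v * (B * 4) with hC₂
  have hC₂0 : 0 < C₂ := by positivity
  refine ⟨max C₁ C₂, lt_max_of_lt_right hC₂0,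
    fun {Ω} _ {P} _ {X ν} h {θ} hθ hψ {t} ht htθ {f} hf x => ?_⟩
  have := h.isProbabilityMeasure_map t
  obtain ⟨u, hu, hinv, htu, htu'⟩ := h.exists_psiInv_eq hα hc hψ ht
  -- Otherwise tψ*(θ) ≥ tψ*(u) = 1. This is the only use of the smallness of t.
  have hθu : θ < u := by
    by_contra hcon
    have := maximalFunction_mono h.continuous_radialExponent hu.le (not_lt.1 hcon)
    have h2 : t * psiStar ν u ≤ t * psiStar ν θ := mul_le_mul_of_nonneg_left this t.coe_nonneg
    linarith
  obtain ⟨hφ, hφle⟩ := hint h hψ hθu hu htu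
  -- Uniform in y, since ‖y‖^d cancels; the value at 0 is then bounded as a supremum.
  have near : ∀ y : E d, y ≠ 0 → f y ≤ ENNReal.ofReal (max C₁ C₂) * psiInv ν (1 / t) ^ d := by
    intro y hy
    have hy0 : 0 < ‖y‖ := norm_pos_iff.2 hy
    have hM : (P.map (X t)).real {z | ‖y‖ / 2 ≤ ‖z‖ ∧ ‖z‖ ≤ ‖y‖} ≤
        Real.exp 1 * ‖y‖ ^ d * (J * u ^ d) :=
      (measureReal_mono fun z hz => hz.2).trans
        ((measureReal_norm_le_le hφ hy0).trans (by gcongr))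
    refine (hf.le_ofReal hy hM).trans ?_
    rw [hinv, ← ENNReal.ofReal_pow hu.le, ← ENNReal.ofReal_mul (by positivity)]
    apply ENNReal.ofReal_le_ofReal
    calc 4 ^ d / v * (Real.exp 1 * ‖y‖ ^ d * (J * u ^ d) / ‖y‖ ^ d) = C₁ * u ^ d := by
          rw [hC₁]; field_simp
      _ ≤ max C₁ C₂ * u ^ d := by gcongr; exact le_max_left _ _
  rw [commonBound]
  split_ifs with hx
  · rw [hx, hf.value_zero]
    exact iSup₂_le near
  · rw [mul_min]
    refine le_min (near x hx) ?_
    have hx0 : 0 < ‖x‖ := norm_pos_iff.2 hx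
    have hM : (P.map (X t)).real {z | ‖x‖ / 2 ≤ ‖z‖ ∧ ‖z‖ ≤ ‖x‖} ≤
        B * (4 * (t * psiStar ν (1 / ‖x‖))) := by
      refine (measureReal_mono fun z hz => hz.1).trans ?_
      have hnn := mul_nonneg hB.le
        (mul_nonneg t.coe_nonneg (radialExponent_nonneg (ν := ν) (1 / (‖x‖ / 2))))
      refine (ENNReal.toReal_mono ENNReal.ofReal_ne_top
        (htail h t (R := ‖x‖ / 2) (by positivity))).trans ?_
      rw [ENNReal.toReal_ofReal hnn]
      have h1 := h.radialExponent_two_mul_le (1 / ‖x‖)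
      have h2 := le_maximalFunction h.continuous_radialExponent
        (show 0 ≤ 1 / ‖x‖ by positivity) le_rfl
      rw [show 1 / (‖x‖ / 2) = 2 * (1 / ‖x‖) by field_simp]
      calc B * (t * radialExponent ν (2 * (1 / ‖x‖)))
          ≤ B * (t * (4 * psiStar ν (1 / ‖x‖))) := by
            gcongr; exact h1.trans (mul_le_mul_of_nonneg_left h2 (by norm_num))
        _ = _ := by ring
    refine (hf.le_ofReal hx hM).trans ?_
    rw [← ENNReal.ofReal_mul (by positivity)]
    apply ENNReal.ofReal_le_ofReal
    have hnn : 0 ≤ t * psiStar ν (1 / ‖x‖) / ‖x‖ ^ d := by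
      have := (radialExponent_nonneg (ν := ν) _).trans (le_maximalFunction
        h.continuous_radialExponent (show 0 ≤ 1 / ‖x‖ by positivity) le_rfl)
      exact div_nonneg (mul_nonneg t.coe_nonneg this) (by positivity)
    calc 4 ^ d / v * (B * (4 * (t * psiStar ν (1 / ‖x‖))) / ‖x‖ ^ d)
        = C₂ * (t * psiStar ν (1 / ‖x‖) / ‖x‖ ^ d) := by rw [hC₂]; ring
      _ ≤ _ := by gcongr; exact le_max_right _ _

end Upper

/-! ### The lower bound. -/

section Lower

lemma half_le_one_sub_exp_neg {T : ℝ} (h0 : 0 ≤ T) (h1 : T ≤ 1) : T / 2 ≤ 1 - Real.exp (-T) := by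
  have h2 : Real.exp (-T) * (1 + T) ≤ 1 := by
    calc Real.exp (-T) * (1 + T) ≤ Real.exp (-T) * Real.exp T := by
          gcongr; linarith [Real.add_one_le_exp T]
      _ = 1 := by rw [← Real.exp_add]; simp
  have h3 := Real.exp_pos (-T)
  nlinarith

/-- On short distances oscillations at frequency `s` are dominated by `δ²` times oscillations at
the frequency `1 / (δ r)`. -/
lemma one_sub_cos_mul_le {s r δ y : ℝ} (hs : 0 ≤ s) (hr : 0 < r) (hsr : s ≤ 1 / r) (hδ : 0 < δ)
    (hy : |y| ≤ δ * r) :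
    1 - Real.cos (s * y) ≤ Real.pi ^ 2 / 4 * δ ^ 2 * (1 - Real.cos (1 / (δ * r) * y)) := by
  set z := 1 / (δ * r) * y with hz
  have hyz : y = δ * r * z := by rw [hz]; field_simp
  have hz1 : |z| ≤ Real.pi := by
    have : |z| ≤ 1 := by
      rw [hz, abs_mul, abs_of_pos (by positivity), one_div_mul_eq_div, div_le_one (by positivity)]
      exact hy
    linarith [Real.pi_gt_three]
  have hcz := Real.cos_le_one_sub_mul_cos_sq hz1
  have hcs := Real.one_sub_sq_div_two_le_cos (x := s * y)
  have hsr1 : s * r ≤ 1 := (le_div_iff₀ hr).1 hsr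
  have hsy : (s * y) ^ 2 ≤ δ ^ 2 * z ^ 2 := by
    calc (s * y) ^ 2 = (s * r) ^ 2 * (δ ^ 2 * z ^ 2) := by rw [hyz]; ring
      _ ≤ 1 * (δ ^ 2 * z ^ 2) := by gcongr; exact pow_le_one₀ (by positivity) hsr1
      _ = _ := one_mul _
  calc 1 - Real.cos (s * y) ≤ δ ^ 2 * z ^ 2 / 2 := by linarith
    _ = Real.pi ^ 2 / 4 * δ ^ 2 * (2 / Real.pi ^ 2 * z ^ 2) := by
        have := Real.pi_pos.ne'
        field_simp; norm_num
    _ ≤ _ := by gcongr; linarith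

variable {d : ℕ} [NeZero d]

/-- The left side is the mean of 1 - cos(s x₀). The integrand is at most 2 for ‖x‖ ≥ δr, and is
compared with frequency 1/(δr) elsewhere. -/
lemma IsPureJumpUnimodalLevyProcess.one_sub_exp_le {Ω : Type*} [MeasurableSpace Ω] {P : Measure Ω}
    [IsProbabilityMeasure P] {X : ℝ≥0 → Ω → E d} {ν : Measure (E d)}
    (h : IsPureJumpUnimodalLevyProcess P X ν) (t : ℝ≥0) {s r δ : ℝ} (hs : 0 ≤ s) (hr : 0 < r)
    (hsr : s ≤ 1 / r) (hδ : 0 < δ) :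
    1 - Real.exp (-(t * radialExponent ν s)) ≤
      2 * (P.map (X t)).real {x | δ * r ≤ ‖x‖} +
        Real.pi ^ 2 / 4 * δ ^ 2 * (t * radialExponent ν (1 / (δ * r))) := by
  have := h.isProbabilityMeasure_map t
  set μ := P.map (X t) with hμ
  set A : Set (E d) := {x | δ * r ≤ ‖x‖} with hA
  have hAm : MeasurableSet A := measurableSet_le measurable_const measurable_norm
  have hval : ∀ u : ℝ, 0 ≤ u → ∫ x : E d, (1 - Real.cos (u * x 0)) ∂μ =
      1 - Real.exp (-(t * radialExponent ν u)) := by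
    intro u hu
    have h1 := integral_one_sub_cos (m := μ) (EuclideanSpace.single 0 u)
    rw [hμ, h.charFun_eq_ofReal, Complex.ofReal_re, h.levyExponent_eq, ← hμ] at h1
    simpa [EuclideanSpace.inner_single_left, abs_of_nonneg hu, mul_comm] using h1
  have hint : ∀ u : ℝ, Integrable (fun x : E d => 1 - Real.cos (u * x 0)) μ := by
    intro u
    refine (integrable_const (2 : ℝ)).mono' (by fun_prop) (ae_of_all _ fun x => ?_)
    rw [Real.norm_eq_abs, abs_le]
    constructor <;> linarith [Real.cos_le_one (u * x 0), Real.neg_one_le_cos (u * x 0)]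
  have hind : Integrable (A.indicator fun _ : E d => (2 : ℝ)) μ :=
    (integrable_const _).indicator hAm
  calc 1 - Real.exp (-(t * radialExponent ν s)) = ∫ x : E d, (1 - Real.cos (s * x 0)) ∂μ :=
        (hval s hs).symm
    _ ≤ ∫ x : E d, (A.indicator (fun _ => (2 : ℝ)) x +
          Real.pi ^ 2 / 4 * δ ^ 2 * (1 - Real.cos (1 / (δ * r) * x 0))) ∂μ := by
        refine integral_mono (hint s) (hind.add ((hint _).const_mul _)) fun x => ?_
        by_cases hx : x ∈ A
        · simp only [Set.indicator_of_mem hx]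
          have h1 := Real.neg_one_le_cos (s * x 0)
          have h2 := Real.cos_le_one (1 / (δ * r) * x 0)
          have h3 : 0 ≤ Real.pi ^ 2 / 4 * δ ^ 2 * (1 - Real.cos (1 / (δ * r) * x 0)) :=
            mul_nonneg (by positivity) (by linarith)
          linarith
        · simp only [Set.indicator_of_notMem hx, zero_add]
          exact one_sub_cos_mul_le hs hr hsr hδ
            ((PiLp.norm_apply_le x 0).trans (not_le.1 hx).le)
    _ = 2 * μ.real A + Real.pi ^ 2 / 4 * δ ^ 2 *
          (1 - Real.exp (-(t * radialExponent ν (1 / (δ * r))))) := by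
        rw [integral_add hind ((hint _).const_mul _), integral_const_mul, hval _ (by positivity),
          integral_indicator_const _ hAm, smul_eq_mul, mul_comm (μ.real A)]
    _ ≤ _ := by
        gcongr
        linarith [Real.one_sub_le_exp_neg (t * radialExponent ν (1 / (δ * r)))]

/-- Two-sided scaling forces mass of order `t ψ*(1/r)` in a fixed multiplicative neighbourhood of
the sphere of radius `r`, hence a lower bound on the density inside. -/
lemma exists_density_lower_bound (d : ℕ) [NeZero d] {α c α' C : ℝ} (hα : 0 < α) (hc : 0 < c)
    (hα' : α' < 2) :
    ∃ (k : ℕ) (K a : ℝ), 0 < K ∧ 0 < a ∧ ∀ {Ω : Type*} [MeasurableSpace Ω] {P : Measure Ω}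
      [IsProbabilityMeasure P] {X : ℝ≥0 → Ω → E d} {ν : Measure (E d)},
      IsPureJumpUnimodalLevyProcess P X ν → ∀ {θ : ℝ}, WLSC (radialExponent ν) α θ c →
      WUSC (radialExponent ν) α' θ C → ∀ {t : ℝ≥0} {f : E d → ℝ≥0∞},
      IsUnimodalDensity (P.map (X t)) f → ∀ {r : ℝ}, 0 < r → θ < 1 / (K * r) →
      t * psiStar ν (1 / r) ≤ 1 → ∀ {x : E d}, 2 ^ k * ‖x‖ ≤ r →
      ENNReal.ofReal (a * (t * psiStar ν (1 / r) / r ^ d)) ≤ f x := by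
  obtain ⟨B, hB, htail⟩ := exists_tail_bound d
  set v := volume.real (Metric.ball (0 : E d) 1) with hvdef
  have hv : 0 < v := volumeReal_ball_pos d
  -- With δ = 2^(-k), the inner region costs δ² and upper scaling from 1/r to 1/(δr) costs C
  -- δ^(-α'); since α' < 2 the product tends to 0.
  obtain ⟨k, hk⟩ : ∃ k : ℕ, Real.pi ^ 2 / 4 * ((1 / 2) ^ k) ^ 2 * (C * (2 ^ k) ^ α') ≤ 1 / 4 := by
    have hq : (2 : ℝ) ^ (α' - 2) < 1 := Real.rpow_lt_one_of_one_lt_of_neg one_lt_two (by linarith)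
    have hlim := ((tendsto_pow_atTop_nhds_zero_of_lt_one (by positivity) hq).const_mul
      (Real.pi ^ 2 / 4 * C))
    rw [mul_zero] at hlim
    obtain ⟨k, hk⟩ := (hlim.eventually_le_const (show (0 : ℝ) < 1 / 4 by norm_num)).exists
    refine ⟨k, le_trans (le_of_eq ?_) hk⟩
    have h1 : ((2 : ℝ) ^ (α' - 2)) ^ k = ((1 / 2) ^ k) ^ 2 * (2 ^ k) ^ α' := by
      rw [Real.rpow_sub two_pos, div_pow, ← Real.rpow_natCast, ← Real.rpow_mul two_pos.le,
        mul_comm α', Real.rpow_mul two_pos.le, Real.rpow_natCast, one_div, inv_pow, inv_pow,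
        div_eq_inv_mul]
      congr 2
      rw [Real.rpow_two, ← pow_mul, ← pow_mul, mul_comm]
    rw [h1]; ring
  -- Lower scaling from 1/(Kr) to 1/r gains c K^α, which must beat 16B so that the tail beyond Kr is
  -- at most T/16.
  obtain ⟨K, hKB, hK1⟩ : ∃ K : ℝ, 16 * B ≤ c * K ^ α ∧ 1 ≤ K :=
    ((((tendsto_rpow_atTop hα).const_mul_atTop hc).eventually_ge_atTop (16 * B)).and
      (eventually_ge_atTop 1)).exists
  have hK : 0 < K := by linarith
  refine ⟨k, K, 1 / (16 * v * K ^ d), hK, by positivity,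
    fun {Ω} _ {P} _ {X ν} h {θ} hL hU {t f} hf {r} hr hθ hT {x} hx => ?_⟩
  have := h.isProbabilityMeasure_map t
  set μ := P.map (X t) with hμ
  set δ : ℝ := (1 / 2) ^ k with hδdef
  have hδ : 0 < δ := by positivity
  have hδk : δ * 2 ^ k = 1 := by rw [hδdef, ← mul_pow]; norm_num
  have ht0 : (0 : ℝ) ≤ t := t.coe_nonneg
  have hr1 : 0 ≤ 1 / r := by positivity
  have hcont := h.continuous_radialExponent
  -- Testing at the maximizer s, rather than at 1/r, makes T = tψ(s) exactly and avoids comparing ψ*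
  -- with ψ.
  obtain ⟨s, hs, hsr, hse⟩ := exists_eq_maximalFunction hcont hr1
  set T := t * psiStar ν (1 / r) with hTdef
  have hTs : t * radialExponent ν s = T := by rw [hse]; rfl
  have hT0 : 0 ≤ T := hTs ▸ mul_nonneg ht0 (radialExponent_nonneg s)
  have hψT : t * radialExponent ν (1 / r) ≤ T :=
    mul_le_mul_of_nonneg_left (le_maximalFunction hcont hr1 le_rfl) ht0
  have hθr : θ < 1 / r := hθ.trans_le (by gcongr; exact le_mul_of_one_le_left hr.le hK1)
  have hfar : T / 8 ≤ μ.real {y | δ * r ≤ ‖y‖} := by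
    have h1 := h.one_sub_exp_le t hs hr hsr hδ
    rw [hTs] at h1
    have h2 := half_le_one_sub_exp_neg hT0 hT
    have h3 := hU (2 ^ k) (1 / r) (one_le_pow₀ one_le_two) hθr
    have h4 : (2 : ℝ) ^ k * (1 / r) = 1 / (δ * r) := by
      rw [eq_div_iff (by positivity)]; field_simp; linarith
    rw [h4] at h3
    have h5 : Real.pi ^ 2 / 4 * δ ^ 2 * (t * radialExponent ν (1 / (δ * r))) ≤ 1 / 4 * T := by
      calc Real.pi ^ 2 / 4 * δ ^ 2 * (t * radialExponent ν (1 / (δ * r)))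
          ≤ Real.pi ^ 2 / 4 * δ ^ 2 * (t * (C * (2 ^ k) ^ α' * radialExponent ν (1 / r))) := by
            gcongr
        _ = Real.pi ^ 2 / 4 * δ ^ 2 * (C * (2 ^ k) ^ α') * (t * radialExponent ν (1 / r)) := by
            ring
        _ ≤ 1 / 4 * T := mul_le_mul hk hψT (mul_nonneg ht0 (radialExponent_nonneg _)) (by norm_num)
    linarith
  have htop : μ.real {y | K * r ≤ ‖y‖} ≤ T / 16 := by
    have h1 := ENNReal.toReal_mono ENNReal.ofReal_ne_top (htail h t (R := K * r) (by positivity))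
    rw [ENNReal.toReal_ofReal
      (mul_nonneg hB.le (mul_nonneg ht0 (radialExponent_nonneg _)))] at h1
    have h2 := hL K (1 / (K * r)) hK1 hθ
    rw [show K * (1 / (K * r)) = 1 / r by field_simp] at h2
    have h3 : 16 * B * (t * radialExponent ν (1 / (K * r))) ≤ T := by
      calc 16 * B * (t * radialExponent ν (1 / (K * r)))
          ≤ c * K ^ α * (t * radialExponent ν (1 / (K * r))) := by
            gcongr; exact mul_nonneg ht0 (radialExponent_nonneg _)
        _ = t * (c * K ^ α * radialExponent ν (1 / (K * r))) := by ring
        _ ≤ t * radialExponent ν (1 / r) := by gcongr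
        _ ≤ T := hψT
    refine h1.trans ?_
    linarith
  set S : Set (E d) := {y | δ * r ≤ ‖y‖} \ {y | K * r ≤ ‖y‖} with hS
  have hSm : MeasurableSet S := (measurableSet_le measurable_const measurable_norm).diff
    (measurableSet_le measurable_const measurable_norm)
  have hSmass : T / 16 ≤ μ.real S := by
    have : μ.real {y | δ * r ≤ ‖y‖} - μ.real {y | K * r ≤ ‖y‖} ≤ μ.real S := le_measureReal_sdiff
    linarith
  have hSvol : volume S ≤ ENNReal.ofReal ((K * r) ^ d * v) := by
    refine (measure_mono (t := Metric.ball (0 : E d) (K * r)) fun y hy => ?_).trans ?_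
    · simpa using hy.2
    · rw [Measure.addHaar_ball_of_pos _ _ (by positivity), finrank_euclideanSpace_fin,
        ENNReal.ofReal_mul (by positivity), hvdef, ofReal_measureReal measure_ball_lt_top.ne]
  have hxr : ‖x‖ ≤ δ * r := by
    calc ‖x‖ = δ * (2 ^ k * ‖x‖) := by rw [← mul_assoc, hδk, one_mul]
      _ ≤ δ * r := by gcongr
  have hmain := hf.measure_le_mul_volume hSm (x := x)
    (fun h0 => by have := h0.1; simp at this; nlinarith [mul_pos hδ hr])
    fun y hy => hxr.trans hy.1
  have h1 : ENNReal.ofReal (T / 16) ≤ f x * ENNReal.ofReal ((K * r) ^ d * v) :=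
    (ENNReal.ofReal_le_ofReal hSmass).trans
      (by rw [ofReal_measureReal]; exact hmain.trans (by gcongr))
  rw [← ENNReal.div_le_iff (by simpa using by positivity) (by simp),
    ← ENNReal.ofReal_div_of_pos (by positivity)] at h1
  refine le_trans (le_of_eq ?_) h1
  congr 1
  rw [mul_pow]; field_simp

theorem exists_lower_bound (d : ℕ) [NeZero d] {α c α' C : ℝ} (hα : 0 < α) (hc : 0 < c)
    (hα' : α' < 2) :
    ∃ cstar r₀ : ℝ, 0 < cstar ∧ 0 < r₀ ∧ ∀ {Ω : Type*} [MeasurableSpace Ω] {P : Measure Ω}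
      [IsProbabilityMeasure P] {X : ℝ≥0 → Ω → E d} {ν : Measure (E d)},
      IsPureJumpUnimodalLevyProcess P X ν → ∀ {θ : ℝ}, 0 ≤ θ → WLSC (radialExponent ν) α θ c →
      WUSC (radialExponent ν) α' θ C → ∀ {t : ℝ≥0}, 0 < t → t * psiStar ν (θ / r₀) < 1 →
      ∀ {f : E d → ℝ≥0∞}, IsUnimodalDensity (P.map (X t)) f → ∀ x : E d, θ * ‖x‖ < r₀ →
      ENNReal.ofReal cstar * commonBound ν t x ≤ f x := by
  obtain ⟨k, K, a, hK, ha, hlow⟩ := exists_density_lower_bound d hα hc hα'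
  -- With r = 2^k ρ, the requirement θ < 1/(Kr) reads θρ < r₀. In the constant, 4^k pays for passing
  -- from ψ*(1/ρ) to ψ*(1/r), and (2^k)^d for r^d against ρ^d.
  set r₀ : ℝ := 1 / (2 ^ k * K) with hr₀
  have hr₀pos : 0 < r₀ := by positivity
  refine ⟨a / (4 ^ k * (2 ^ k) ^ d), r₀, by positivity, hr₀pos,
    fun {Ω} _ {P} _ {X ν} h {θ} hθ hL hU {t} ht htθ {f} hf x hx => ?_⟩
  obtain ⟨u, hu, hinv, htu, htu'⟩ := h.exists_psiInv_eq hα hc hL ht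
  have ht0 : (0 : ℝ) ≤ t := t.coe_nonneg
  have hcont := h.continuous_radialExponent
  have hmono : ∀ {v w : ℝ}, 0 ≤ v → v ≤ w → t * psiStar ν v ≤ t * psiStar ν w := fun hv hvw =>
    mul_le_mul_of_nonneg_left (maximalFunction_mono hcont hv hvw) ht0
  have hθu : θ / r₀ < u := by
    by_contra hcon
    linarith [hmono hu.le (not_lt.1 hcon)]
  -- Used with ρ = 1/u, where the bound becomes u^d, and with ρ = ‖x‖. The condition 1/u ≤ ρ ensures
  -- tψ*(1/r) ≤ 1.
  have key : ∀ ρ : ℝ, ‖x‖ ≤ ρ → 1 / u ≤ ρ → θ * ρ < r₀ →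
      ENNReal.ofReal (a / (4 ^ k * (2 ^ k) ^ d)) *
        ENNReal.ofReal (t * psiStar ν (1 / ρ) / ρ ^ d) ≤ f x := by
    intro ρ hxρ huρ hθρ
    have hρ : 0 < ρ := (by positivity : 0 < 1 / u).trans_le huρ
    have h1ρ : 1 / ρ ≤ u := (one_div_le hρ hu).2 huρ
    have hle : 1 / (2 ^ k * ρ) ≤ 1 / ρ := by
      gcongr; exact le_mul_of_one_le_left hρ.le (one_le_pow₀ one_le_two)
    have h1 : t * psiStar ν (1 / (2 ^ k * ρ)) ≤ 1 :=
      (hmono (by positivity) (hle.trans h1ρ)).trans_eq htu'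
    have h2 : θ < 1 / (K * (2 ^ k * ρ)) := by
      have : 1 / (K * (2 ^ k * ρ)) = r₀ / ρ := by rw [hr₀]; field_simp
      rw [this, lt_div_iff₀ hρ]; exact hθρ
    have h3 := hlow h hL hU hf (r := 2 ^ k * ρ) (by positivity) h2 h1 (x := x) (by gcongr)
    rw [← ENNReal.ofReal_mul (by positivity)]
    refine (ENNReal.ofReal_le_ofReal ?_).trans h3
    have h4 := h.psiStar_two_pow_mul_le k (u := 1 / (2 ^ k * ρ)) (by positivity)
    rw [show (2 : ℝ) ^ k * (1 / (2 ^ k * ρ)) = 1 / ρ by field_simp] at h4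
    calc a / (4 ^ k * (2 ^ k) ^ d) * (t * psiStar ν (1 / ρ) / ρ ^ d)
        ≤ a / (4 ^ k * (2 ^ k) ^ d) * (t * (4 ^ k * psiStar ν (1 / (2 ^ k * ρ))) / ρ ^ d) := by
          gcongr
      _ = a * (t * psiStar ν (1 / (2 ^ k * ρ)) / (2 ^ k * ρ) ^ d) := by
          rw [mul_pow]; field_simp
  have hnear : ‖x‖ ≤ 1 / u → ENNReal.ofReal (a / (4 ^ k * (2 ^ k) ^ d)) * psiInv ν (1 / t) ^ d ≤
      f x := by
    intro hxu
    have h1 := key (1 / u) hxu le_rfl (by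
      rw [mul_one_div, div_lt_iff₀ hu, mul_comm]; exact (div_lt_iff₀ hr₀pos).1 hθu)
    rwa [one_div_one_div, htu', ← one_div_pow, one_div_one_div,
      ENNReal.ofReal_pow hu.le, ← hinv] at h1
  rw [commonBound]
  split_ifs with hx0
  · exact hnear (by rw [hx0, norm_zero]; positivity)
  · rcases le_total ‖x‖ (1 / u) with hxu | hxu
    · exact le_trans (by gcongr; exact min_le_left _ _) (hnear hxu)
    · exact le_trans (by gcongr; exact min_le_right _ _) (key ‖x‖ le_rfl hxu hx)

end Lower

end UnimodalLevy

theorem theorem4 (d : ℕ) [NeZero d] (α c : ℝ) (hα : 0 < α) (hα2 : α < 2)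
    (hc : 0 < c) (hc1 : c ≤ 1) :
    (∃ Cstar : ℝ, 0 < Cstar ∧
      ∀ (θ : ℝ), 0 ≤ θ →
      ∀ (Ω : Type*) [MeasurableSpace Ω] (P : Measure Ω) [IsProbabilityMeasure P]
        (X : ℝ≥0 → Ω → E d) (ν : Measure (E d)) (p : ℝ≥0 → E d → ℝ≥0∞),
        IsPureJumpUnimodalLevyProcess P X ν → IsTransitionDensity P X p →
        WLSC (radialExponent ν) α θ c →
        ∀ t : ℝ≥0, 0 < t → t * psiStar ν θ < 1 / Real.pi ^ 2 →
        ∀ x : E d, p t x ≤ ENNReal.ofReal Cstar * commonBound ν t x) ∧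
    (∀ (α' C : ℝ), 0 < α' → α' < 2 → 1 ≤ C →
      ∃ cstar r₀ : ℝ, 0 < cstar ∧ 0 < r₀ ∧
      ∀ (θ : ℝ), 0 ≤ θ →
      ∀ (Ω : Type*) [MeasurableSpace Ω] (P : Measure Ω) [IsProbabilityMeasure P]
        (X : ℝ≥0 → Ω → E d) (ν : Measure (E d)) (p : ℝ≥0 → E d → ℝ≥0∞),
        IsPureJumpUnimodalLevyProcess P X ν → IsTransitionDensity P X p →
        WLSC (radialExponent ν) α θ c → WUSC (radialExponent ν) α' θ C →
        ∀ t : ℝ≥0, 0 < t → t * psiStar ν (θ / r₀) < 1 →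
        ∀ x : E d, θ * ‖x‖ < r₀ →
          ENNReal.ofReal cstar * commonBound ν t x ≤ p t x) := by
  constructor
  · obtain ⟨Cstar, hC, hupper⟩ := exists_upper_bound d hα hc
    refine ⟨Cstar, hC, fun θ hθ Ω _ P _ X ν p h hp hL t ht htθ x =>
      hupper h hθ hL ht (htθ.trans ?_) (hp t ht) x⟩
    -- Since 1/π² < 1, the assumption implies the condition tψ*(θ) < 1 that the upper bound needs.
    rw [div_lt_one (by positivity)]
    nlinarith [Real.pi_gt_three]
  · intro α' C _ hα' _
    obtain ⟨cstar, r₀, hc0, hr0, hlower⟩ := exists_lower_bound d (C := C) hα hc hα'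
    exact ⟨cstar, r₀, hc0, hr0, fun θ hθ Ω _ P _ X ν p h hp hL hU t ht htθ x hx =>
      hlower h hθ hL hU ht htθ (hp t ht) x hx⟩
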